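/- Let $d\ge 0$ be an integer and $\alpha\in(0,1/2)$. Let $\mathcal K$ be a set of infinitely divisible probability measures on $\mathbb R^d$ that is closed under weak convergence, closed under convolution, and such that for every $c>0$ and $\nu\in\mathcal K$ also the dilation $T_c\nu$ (the image of $\nu$ under $x\mapsto cx$) and the convolution power $\nu^{*c}$ (the member at time $c$ of the weakly continuous convolution semigroup $(\mu_s)_{s\ge0}$ of probability measures with $\mu_0=\delta_0$, $\mu_1=\nu$) belong to $\mathcal K$. Let $\nu\in\mathcal K$, and let $Y_1,Y_2$ be two independent Lévy processes $(Y_i(s))_{s\ge 0}$ in $\mathbb R^d$ (processes with stationary independent increments, started at $0$, with right-continuous paths having left limits) with $\mathcal L(Y_1(1))=\mathcal L(Y_2(1))=\nu$. Let $Y(s)=Y_1(s)$ for $s\ge 0$ and $Y(s)=-Y_2((-s)-)$ for $s<0$ be the associated two-sided Lévy process. For $h$ of bounded variation on $[a,b]$ and a path $y$ with left limits put $$\int_{(a,b]}h(s)\,dy(s):=h(b)y(b)-h(a)y(a)-\int_{(a,b]}y(s-)\,dh(s),$$ and for $t,b>0$ put $$U^{(\nu),b}(t):=\int_{(0,b]}\big((t+s)^{\alpha}-s^{\alpha}\big)\,dY_2(s),\qquad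 V^{(\nu)}(t):=\int_{(0,t]}(t-s)^{\alpha}\,dY_1(s).$$ (a) For all $t>0$ and $b>0$, the law of $U^{(\nu),b}(t)+V^{(\nu)}(t)$ belongs to $\mathcal K$. (b) For every $t>0$: if the improper integral $$Z(t)=\int_{\mathbb R}\big((t-s)_+^{\alpha}-(-s)_+^{\alpha}\big)\,dY(s)$$ is well defined, i.e. the integrals over $(-a,b]$ converge in distribution to $Z(t)$ as $a,b\to\infty$ (in particular, if they converge almost surely or in probability), then $\mathcal L(Z(t))\in\mathcal K$. Consequently, if the moving average fractional Lévy process $Z$ is well defined, all its marginal laws $\mathcal L(Z(t))$, $t>0$, belong to $\mathcal K$. -/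

import Mathlib

open MeasureTheory ProbabilityTheory Filter Set
open scoped NNReal Topology

noncomputable section

namespace FractionalLevy

/-! ### Infinitely divisible laws and convolution classes on `ℝᵈ` -/

section Laws

variable {d : ℕ}

/-- The `n`-fold convolution `μ ∗ ⋯ ∗ μ` (the point mass at `0` for `n = 0`). -/
def nfoldConv (μ : Measure (EuclideanSpace ℝ (Fin d))) : ℕ → Measure (EuclideanSpace ℝ (Fin d))
  | 0 => Measure.dirac 0
  | n + 1 => (nfoldConv μ n).conv μ

/-- `ν` is infinitely divisible: for every `n ≥ 1` it is the `n`-fold convolution of some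
probability law. -/
def IsInfinitelyDivisible (ν : ProbabilityMeasure (EuclideanSpace ℝ (Fin d))) : Prop :=
  ∀ n : ℕ, 1 ≤ n → ∃ μ : ProbabilityMeasure (EuclideanSpace ℝ (Fin d)),
    nfoldConv (μ : Measure (EuclideanSpace ℝ (Fin d))) n = ν

/-- The convolution of two probability laws. -/
def probConv (μ ν : ProbabilityMeasure (EuclideanSpace ℝ (Fin d))) :
    ProbabilityMeasure (EuclideanSpace ℝ (Fin d)) :=
  ⟨(μ : Measure (EuclideanSpace ℝ (Fin d))).conv (ν : Measure (EuclideanSpace ℝ (Fin d))),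
    inferInstance⟩

/-- The dilation `T_c ν`, i.e. the image of `ν` under `x ↦ c • x`. -/
def dilation (c : ℝ) (ν : ProbabilityMeasure (EuclideanSpace ℝ (Fin d))) :
    ProbabilityMeasure (EuclideanSpace ℝ (Fin d)) :=
  ν.map (f := fun x => c • x) (measurable_const_smul c).aemeasurable

/-- `ρ` is the convolution power `ν^{∗c}` with a real exponent `c ≥ 0`: the member at time `c` of the
weakly continuous convolution semigroup of probability laws that starts at the point mass at `0`
and equals `ν` at time `1` (such a semigroup exists for, and is determined by, an infinitely
divisible `ν`). -/
def IsConvPow (ν : ProbabilityMeasure (EuclideanSpace ℝ (Fin d))) (c : ℝ≥0)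
    (ρ : ProbabilityMeasure (EuclideanSpace ℝ (Fin d))) : Prop :=
  ∃ μ : ℝ≥0 → ProbabilityMeasure (EuclideanSpace ℝ (Fin d)),
    Continuous μ ∧ (μ 0 : Measure (EuclideanSpace ℝ (Fin d))) = Measure.dirac 0 ∧
    (∀ s t, μ (s + t) = probConv (μ s) (μ t)) ∧ μ 1 = ν ∧ μ c = ρ

/-- A closed (for weak convergence) convolution semigroup of infinitely divisible laws that is
also closed under dilations `T_c` and convolution powers `ν^{∗c}`, `c > 0`. -/
structure IsClosedConvClass (K : Set (ProbabilityMeasure (EuclideanSpace ℝ (Fin d)))) : Prop where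
  infinitelyDivisible : ∀ ν ∈ K, IsInfinitelyDivisible ν
  isClosed : IsClosed K
  conv_mem : ∀ μ ∈ K, ∀ ν ∈ K, probConv μ ν ∈ K
  dilation_mem : ∀ c : ℝ, 0 < c → ∀ ν ∈ K, dilation c ν ∈ K
  convPow_mem : ∀ c : ℝ≥0, 0 < c → ∀ ν ∈ K, ∀ ρ, IsConvPow ν c ρ → ρ ∈ K

end Laws

/-! ### Lévy processes -/

section Processes

variable {d : ℕ} {Ω : Type*} [MeasurableSpace Ω]

/-- `Y` is a Lévy process in `ℝᵈ` with `Law (Y 1) = ν`: it starts from zero, has stationary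
independent increments and right-continuous paths with finite left limits. -/
structure IsLevyProcess (P : Measure Ω) (ν : ProbabilityMeasure (EuclideanSpace ℝ (Fin d)))
    (Y : ℝ≥0 → Ω → EuclideanSpace ℝ (Fin d)) : Prop where
  measurable : ∀ t, Measurable (Y t)
  start_zero : ∀ᵐ ω ∂P, Y 0 ω = 0
  indep_increments : HasIndepIncrements Y P
  stationary_increments : ∀ s t, IdentDistrib (Y (s + t) - Y s) (Y t) P P
  cadlag : ∀ᵐ ω ∂P, ∀ t, ContinuousWithinAt (fun s => Y s ω) (Ici t) t ∧
    ∃ l, Tendsto (fun s => Y s ω) (𝓝[<] t) (𝓝 l)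
  law_one : HasLaw (Y 1) (ν : Measure (EuclideanSpace ℝ (Fin d))) P

/-- The paths of a process on `[0, ∞)`, written as functions on `ℝ` (constant on `(-∞, 0]`). -/
def halfLine (Y : ℝ≥0 → Ω → EuclideanSpace ℝ (Fin d)) (ω : Ω) (s : ℝ) :
    EuclideanSpace ℝ (Fin d) :=
  Y s.toNNReal ω

/-- The two-sided process made of `Y₁` on `[0, ∞)` and of `Y₂` on the negative half-line:
`Y(s) = Y₁(s)` for `s ≥ 0` and `Y(s) = -Y₂((-s)-)` for `s < 0`. With `Y₁`, `Y₂` independent Lévy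
processes with the same law at time `1` this is a two-sided Lévy process. -/
def twoSided (Y₁ Y₂ : ℝ≥0 → Ω → EuclideanSpace ℝ (Fin d)) (ω : Ω) (s : ℝ) :
    EuclideanSpace ℝ (Fin d) :=
  if 0 ≤ s then halfLine Y₁ ω s else -Function.leftLim (halfLine Y₂ ω) (-s)

end Processes

/-! ### Random integrals -/

section Integrals

variable {d : ℕ}

open scoped Classical in
/-- The integral `∫_{(a,b]} h(s) dy(s)` of a function `h` of bounded variation on `[a, b]` along a
path `y` with left limits, defined through integration by parts:
`h(b) y(b) - h(a) y(a) - ∫_{(a,b]} y(s-) dh(s)`, the last integral being a Lebesgue-Stieltjes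
integral. The function `h` is frozen outside `[a, b]`, so that `dh` is a finite signed measure and
only the values of `h` on `[a, b]` matter. -/
def pathIntegral (a b : ℝ) (h : ℝ → ℝ) (y : ℝ → EuclideanSpace ℝ (Fin d)) :
    EuclideanSpace ℝ (Fin d) :=
  if hh : BoundedVariationOn (fun s => h (max a (min s b))) univ then
    h b • y b - h a • y a -
      ∫ᵛ s in Ioc a b, Function.leftLim y s ∂<•hh.vectorMeasure
  else 0

variable {Ω Ω' : Type*} [MeasurableSpace Ω] [MeasurableSpace Ω']

/-- The improper random integral `∫_ℝ h(s) dY(s)` of a path-valued `Y` is well defined and equal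
(in law) to `X`: `X` is the limit in distribution of `∫_{(-a,b]} h(s) dY(s)` as `a, b → ∞`. Limits
almost surely or in probability are special cases. -/
def IsImproperIntegral (P : Measure Ω) [IsProbabilityMeasure P] (P' : Measure Ω')
    [IsProbabilityMeasure P'] (h : ℝ → ℝ) (Y : Ω → ℝ → EuclideanSpace ℝ (Fin d))
    (X : Ω' → EuclideanSpace ℝ (Fin d)) : Prop :=
  TendstoInDistribution
    (fun (p : ℝ≥0 × ℝ≥0) ω => pathIntegral (-(p.1 : ℝ)) (p.2 : ℝ) h (Y ω))
    atTop X (fun _ => P) P'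

/-- `U^{(ν),b}(t) = ∫_{(0,b]} ((t+s)^α - s^α) dY(s)`. -/
def truncU (α t b : ℝ) (Y : ℝ≥0 → Ω → EuclideanSpace ℝ (Fin d)) (ω : Ω) :
    EuclideanSpace ℝ (Fin d) :=
  pathIntegral 0 b (fun s => (t + s) ^ α - s ^ α) (halfLine Y ω)

/-- `V^{(ν)}(t) = ∫_{(0,t]} (t-s)^α dY(s)`. -/
def partV (α t : ℝ) (Y : ℝ≥0 → Ω → EuclideanSpace ℝ (Fin d)) (ω : Ω) :
    EuclideanSpace ℝ (Fin d) :=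
  pathIntegral 0 t (fun s => (t - s) ^ α) (halfLine Y ω)

/-- The moving average kernel `s ↦ (t-s)₊^α - (-s)₊^α`. -/
def maKernel (α t s : ℝ) : ℝ :=
  (max 0 (t - s)) ^ α - (max 0 (-s)) ^ α

/-- `Z` is the value at time `t` of the moving average fractional Lévy process driven by the
two-sided process made of `Y₁` and `Y₂`:
`Z(t) = ∫_ℝ ((t-s)₊^α - (-s)₊^α) dY(s)`, and this improper integral is well defined. -/
def IsMAFLPValue (P : Measure Ω) [IsProbabilityMeasure P] (P' : Measure Ω')
    [IsProbabilityMeasure P'] (α : ℝ) (Y₁ Y₂ : ℝ≥0 → Ω → EuclideanSpace ℝ (Fin d)) (t : ℝ)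
    (Z : Ω' → EuclideanSpace ℝ (Fin d)) : Prop :=
  IsImproperIntegral P P' (maKernel α t) (twoSided Y₁ Y₂) Z

end Integrals

end FractionalLevy

end

open MeasureTheory ProbabilityTheory Filter Set
open scoped NNReal Topology

noncomputable section

namespace FractionalLevy

/-! ### Functions of bounded variation frozen outside an interval -/

section Frozen

/-! For a continuous integrand `h ≥ 0` of bounded variation, the integral is the pathwise limit of
Riemann sums `∑ h(tᵢ₊₁) • (Y(tᵢ₊₁) - Y(tᵢ))`: Abel summation turns such a sum into the
integration-by-parts formula with `y(s-)` replaced by a step function, and dominated convergence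
does the rest (`tendsto_riemannSum`).

The terms of a sum are independent, and each is a nonnegative multiple of an increment with law
`ν^{∗(tᵢ₊₁ - tᵢ)}`. Hence the law of the sum is in `K` (`IsLevyProcess.hasLawIn_sum`), and weak
closedness passes this to the limit. The sign of `h` is essential, since `K` is stable only under
positive dilations; both kernels in (a) and the moving average kernel are nonnegative.

For (b), increments of the two-sided process over negative times are forward increments of `Y₂` in
reversed order, with a plus sign. So the integrals over `(-a, b]` also have laws in `K`
(`hasLawIn_pathIntegral_twoSided`), and closedness is used once more as `a, b → ∞`. -/

lemma boundedVariationOn_sub {s : Set ℝ} {f g : ℝ → ℝ} (hf : BoundedVariationOn f s)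
    (hg : BoundedVariationOn g s) : BoundedVariationOn (fun x => f x - g x) s := by
  refine ne_top_of_le_ne_top (ENNReal.add_ne_top.2 ⟨hf, hg⟩) (iSup_le ?_)
  rintro ⟨n, ⟨u, hu, us⟩⟩
  calc ∑ i ∈ Finset.range n, edist (f (u (i + 1)) - g (u (i + 1))) (f (u i) - g (u i))
      ≤ ∑ i ∈ Finset.range n,
          (edist (f (u (i + 1))) (f (u i)) + edist (g (u (i + 1))) (g (u i))) := by
        refine Finset.sum_le_sum fun i _ => ?_
        simp only [edist_dist]
        rw [← ENNReal.ofReal_add dist_nonneg dist_nonneg]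
        exact ENNReal.ofReal_le_ofReal (dist_sub_sub_le _ _ _ _)
    _ ≤ eVariationOn f s + eVariationOn g s := by
        rw [Finset.sum_add_distrib]
        exact add_le_add (eVariationOn.sum_le hu us) (eVariationOn.sum_le hu us)

lemma clamp_mem {a b : ℝ} (hab : a ≤ b) (s : ℝ) : max a (min s b) ∈ Icc a b :=
  ⟨le_max_left _ _, max_le hab (min_le_right _ _)⟩

lemma clamp_eq {a b s : ℝ} (hs : s ∈ Icc a b) : max a (min s b) = s := by
  rw [min_eq_left hs.2, max_eq_right hs.1]

lemma boundedVariationOn_frozen {a b : ℝ} (hab : a ≤ b) {f : ℝ → ℝ}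
    (hf : MonotoneOn f (Icc a b)) :
    BoundedVariationOn (fun s => f (max a (min s b))) univ := by
  refine MonotoneOn.boundedVariationOn (C := max |f a| |f b|) ?_ ?_
  · intro x _ y _ hxy
    exact hf (clamp_mem hab x) (clamp_mem hab y) (max_le_max le_rfl (min_le_min hxy le_rfl))
  · intro x _
    have hx := clamp_mem hab x
    have h1 := hf (left_mem_Icc.2 hab) hx hx.1
    have h2 := hf hx (right_mem_Icc.2 hab) hx.2
    rw [abs_le]
    constructor
    · linarith [neg_abs_le (f a), le_max_left |f a| |f b|]
    · linarith [le_abs_self (f b), le_max_right |f a| |f b|]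

lemma boundedVariationOn_frozen_of_eq_sub {a b : ℝ} (hab : a ≤ b) {f g h : ℝ → ℝ}
    (hf : MonotoneOn f (Icc a b)) (hg : MonotoneOn g (Icc a b))
    (h_eq : ∀ s ∈ Icc a b, h s = f s - g s) :
    BoundedVariationOn (fun s => h (max a (min s b))) univ := by
  have : (fun s => h (max a (min s b)))
      = fun s => f (max a (min s b)) - g (max a (min s b)) :=
    funext fun s => h_eq _ (clamp_mem hab s)
  rw [this]
  exact boundedVariationOn_sub (boundedVariationOn_frozen hab hf) (boundedVariationOn_frozen hab hg)

/-- Finiteness lets bounded functions be integrated against `dh` and constants serve as dominating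
functions. -/
instance isFiniteMeasure_variation_signedMeasure {X : Type*} [MeasurableSpace X]
    (μ : SignedMeasure X) : IsFiniteMeasure μ.variation := by
  rw [← SignedMeasure.totalVariation_eq_variation]
  unfold SignedMeasure.totalVariation
  infer_instance

lemma vectorMeasure_frozen_Ioc {a b : ℝ} {h : ℝ → ℝ} (hab : a ≤ b)
    (hc : ContinuousOn h (Icc a b))
    (hh : BoundedVariationOn (fun s => h (max a (min s b))) univ) {u v : ℝ} (hu : u ∈ Icc a b)
    (hv : v ∈ Icc a b) (huv : u ≤ v) : hh.vectorMeasure (Ioc u v) = h v - h u := by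
  have hcont : Continuous fun s => h (max a (min s b)) :=
    hc.comp_continuous (by fun_prop) (clamp_mem hab)
  rw [hh.vectorMeasure_Ioc huv, hcont.continuousWithinAt.rightLim_eq,
    hcont.continuousWithinAt.rightLim_eq, clamp_eq hu, clamp_eq hv]

end Frozen

/-! ### Càdlàg functions on the line -/

section Cadlag

variable {E : Type*} [NormedAddCommGroup E]

/-- `y` is right-continuous and has left limits at every point of the line. -/
def IsCadlag (y : ℝ → E) : Prop :=
  ∀ s, ContinuousWithinAt y (Ici s) s ∧ ∃ l, Tendsto y (𝓝[<] s) (𝓝 l)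

lemma IsCadlag.tendsto_leftLim {y : ℝ → E} (hy : IsCadlag y) (s : ℝ) :
    Tendsto y (𝓝[<] s) (𝓝 (Function.leftLim y s)) :=
  tendsto_leftLim_of_tendsto (hy s).2

/-- Compactness: near each point, `y` stays within distance 1 of its left limit or of its value
there. -/
lemma IsCadlag.exists_norm_le {y : ℝ → E} (hy : IsCadlag y) (a b : ℝ) :
    ∃ C, ∀ s ∈ Icc a b, ‖y s‖ ≤ C := by
  have key : Bornology.IsBounded (y '' Icc a b) := by
    refine (isCompact_Icc (a := a) (b := b)).induction_on (p := fun s => Bornology.IsBounded (y '' s))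
      (by simp) (fun s t hst ht => ht.subset (image_mono hst))
      (fun s t hs ht => by rw [image_union]; exact hs.union ht) (fun x _ => ?_)
    obtain ⟨l, hl⟩ := (hy x).2
    have h1 : ∀ᶠ z in 𝓝[<] x, y z ∈ Metric.ball l 1 := hl (Metric.ball_mem_nhds l one_pos)
    have h2 : ∀ᶠ z in 𝓝[≥] x, y z ∈ Metric.ball (y x) 1 :=
      (hy x).1 (Metric.ball_mem_nhds (y x) one_pos)
    refine ⟨y ⁻¹' (Metric.ball l 1 ∪ Metric.ball (y x) 1), ?_, ?_⟩
    · refine mem_nhdsWithin_of_mem_nhds ?_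
      rw [← nhdsLT_sup_nhdsGE x]
      exact mem_sup.2 ⟨h1.mono fun z hz => Or.inl hz, h2.mono fun z hz => Or.inr hz⟩
    · exact (Metric.isBounded_ball.union Metric.isBounded_ball).subset (image_preimage_subset _ _)
  obtain ⟨C, hC⟩ := key.exists_norm_le
  exact ⟨C, fun s hs => hC _ (mem_image_of_mem _ hs)⟩

/-- For `r` slightly above `s`, the left limit at `r` is a limit of values on `(s, r)`, all of which
lie in a prescribed closed neighbourhood of `y s`. -/
lemma IsCadlag.tendsto_leftLim_nhdsGT {y : ℝ → E} (hy : IsCadlag y) (s : ℝ) :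
    Tendsto (Function.leftLim y) (𝓝[>] s) (𝓝 (y s)) := by
  refine (closed_nhds_basis (y s)).tendsto_right_iff.2 ?_
  rintro U ⟨hU, hUc⟩
  have h1 : ∀ᶠ z in 𝓝[>] s, y z ∈ U := ((hy s).1.mono Ioi_subset_Ici_self) hU
  obtain ⟨c, hc, hcU⟩ := mem_nhdsGT_iff_exists_Ioo_subset.1 h1
  filter_upwards [Ioo_mem_nhdsGT hc] with r hr
  refine hUc.mem_of_tendsto (hy.tendsto_leftLim r) ?_
  filter_upwards [Ioo_mem_nhdsLT hr.1] with z hz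
  exact hcU ⟨hz.1, hz.2.trans hr.2⟩

lemma IsCadlag.reflect {y : ℝ → E} (hy : IsCadlag y) :
    IsCadlag fun s => -Function.leftLim y (-s) := by
  intro s
  constructor
  · have h := continuousWithinAt_leftLim_Iic (hy.tendsto_leftLim (-s))
    refine ContinuousWithinAt.neg ?_
    refine ContinuousWithinAt.comp (t := Iic (-s)) h continuous_neg.continuousWithinAt ?_
    intro r hr
    simpa using hr
  · refine ⟨-y (-s), Tendsto.neg ?_⟩
    refine (hy.tendsto_leftLim_nhdsGT (-s)).comp ?_
    refine tendsto_nhdsWithin_iff.2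
      ⟨(continuous_neg.tendsto s).mono_left nhdsWithin_le_nhds, ?_⟩
    filter_upwards [self_mem_nhdsWithin] with r hr
    simpa using hr

lemma IsCadlag.piecewise {y z : ℝ → E} (hy : IsCadlag y) (hz : IsCadlag z) :
    IsCadlag fun s => if 0 ≤ s then y s else z s := by
  intro s
  rcases lt_or_ge s 0 with hs | hs
  · have h : (fun s => if 0 ≤ s then y s else z s) =ᶠ[𝓝 s] z := by
      filter_upwards [Iio_mem_nhds hs] with r hr
      simp [not_le.2 (mem_Iio.1 hr)]
    refine ⟨(hz s).1.congr_of_eventuallyEq (h.filter_mono nhdsWithin_le_nhds) h.self_of_nhds, ?_⟩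
    obtain ⟨l, hl⟩ := (hz s).2
    exact ⟨l, hl.congr' (h.filter_mono nhdsWithin_le_nhds).symm⟩
  · constructor
    · refine (hy s).1.congr (fun r hr => ?_) ?_
      · simp [hs.trans hr]
      · simp [hs]
    · rcases hs.eq_or_lt with rfl | hs
      · obtain ⟨l, hl⟩ := (hz 0).2
        refine ⟨l, hl.congr' ?_⟩
        filter_upwards [self_mem_nhdsWithin] with r hr
        simp [not_le.2 (mem_Iio.1 hr)]
      · obtain ⟨l, hl⟩ := (hy s).2
        refine ⟨l, hl.congr' ?_⟩
        filter_upwards [nhdsWithin_le_nhds (Ioi_mem_nhds hs)] with r hr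
        simp [(mem_Ioi.1 hr).le]

lemma isCadlag_comp_toNNReal {y : ℝ≥0 → E}
    (hy : ∀ t, ContinuousWithinAt y (Ici t) t ∧ ∃ l, Tendsto y (𝓝[<] t) (𝓝 l)) :
    IsCadlag fun s : ℝ => y s.toNNReal := by
  intro s
  constructor
  · exact ContinuousWithinAt.comp (t := Ici s.toNNReal) (hy _).1
      continuous_real_toNNReal.continuousWithinAt fun r hr => Real.toNNReal_le_toNNReal hr
  · rcases le_or_gt s 0 with hs | hs
    · refine ⟨y 0, tendsto_const_nhds.congr' ?_⟩
      filter_upwards [self_mem_nhdsWithin] with r hr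
      rw [Real.toNNReal_of_nonpos (le_trans (le_of_lt hr) hs)]
    · obtain ⟨l, hl⟩ := (hy s.toNNReal).2
      refine ⟨l, hl.comp ?_⟩
      refine tendsto_nhdsWithin_iff.2
        ⟨(continuous_real_toNNReal.tendsto s).mono_left nhdsWithin_le_nhds, ?_⟩
      filter_upwards [self_mem_nhdsWithin] with r hr
      exact (Real.toNNReal_lt_toNNReal_iff hs).2 hr

end Cadlag

/-! ### Approximation of path integrals by Riemann sums -/

section Riemann

/-- The `i`-th point of the uniform partition of `[a, b]` into `n + 1` intervals. -/
def gridPoint (a b : ℝ) (n i : ℕ) : ℝ := a + i * ((b - a) / (n + 1))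

lemma gridPoint_zero (a b : ℝ) (n : ℕ) : gridPoint a b n 0 = a := by simp [gridPoint]

lemma gridPoint_last (a b : ℝ) (n : ℕ) : gridPoint a b n (n + 1) = b := by
  have : (n : ℝ) + 1 ≠ 0 := by positivity
  simp only [gridPoint]
  push_cast
  field_simp
  ring

lemma monotone_gridPoint {a b : ℝ} (hab : a ≤ b) (n : ℕ) : Monotone (gridPoint a b n) := by
  intro i j hij
  have h : 0 ≤ (b - a) / (n + 1) := div_nonneg (sub_nonneg.2 hab) (by positivity)
  have hij' : (i : ℝ) ≤ j := by exact_mod_cast hij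
  simp only [gridPoint]
  gcongr

lemma gridPoint_mem {a b : ℝ} (hab : a ≤ b) {n i : ℕ} (hi : i ≤ n + 1) :
    gridPoint a b n i ∈ Icc a b :=
  ⟨(gridPoint_zero a b n).symm.le.trans (monotone_gridPoint hab n (Nat.zero_le i)),
    (monotone_gridPoint hab n hi).trans (gridPoint_last a b n).le⟩

/-- The last point of the uniform partition of `[a, b]` into `n + 1` intervals that is strictly
below `s`. -/
def gridBelow (a b : ℝ) (n : ℕ) (s : ℝ) : ℝ :=
  a + ((⌈(s - a) / ((b - a) / (n + 1))⌉ - 1 : ℤ) : ℝ) * ((b - a) / (n + 1))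

lemma gridBelow_eq {a b : ℝ} (hab : a < b) {n i : ℕ} {s : ℝ}
    (hs : s ∈ Ioc (gridPoint a b n i) (gridPoint a b n (i + 1))) :
    gridBelow a b n s = gridPoint a b n i := by
  have h : 0 < (b - a) / (n + 1) := div_pos (sub_pos.2 hab) (by positivity)
  have hceil : ⌈(s - a) / ((b - a) / (n + 1))⌉ = (i : ℤ) + 1 := by
    rw [Int.ceil_eq_iff]
    simp only [gridPoint, mem_Ioc] at hs
    push_cast at hs ⊢
    rw [lt_div_iff₀ h, div_le_iff₀ h]
    constructor <;> linarith [hs.1, hs.2]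
  simp [gridBelow, gridPoint, hceil]

lemma gridBelow_lt {a b : ℝ} (hab : a < b) (n : ℕ) (s : ℝ) : gridBelow a b n s < s := by
  have h : 0 < (b - a) / (n + 1) := div_pos (sub_pos.2 hab) (by positivity)
  have h1 := Int.ceil_lt_add_one ((s - a) / ((b - a) / (n + 1)))
  have h2 := mul_lt_mul_of_pos_right h1 h
  rw [add_mul, div_mul_cancel₀ _ h.ne'] at h2
  simp only [gridBelow]
  push_cast
  linarith

lemma sub_le_gridBelow {a b : ℝ} (hab : a < b) (n : ℕ) (s : ℝ) :
    s - (b - a) / (n + 1) ≤ gridBelow a b n s := by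
  have h : 0 < (b - a) / (n + 1) := div_pos (sub_pos.2 hab) (by positivity)
  have h1 := Int.le_ceil ((s - a) / ((b - a) / (n + 1)))
  have h2 := mul_le_mul_of_nonneg_right h1 h.le
  rw [div_mul_cancel₀ _ h.ne'] at h2
  simp only [gridBelow]
  push_cast
  linarith

lemma le_gridBelow {a b : ℝ} (hab : a < b) (n : ℕ) {s : ℝ} (hs : a < s) :
    a ≤ gridBelow a b n s := by
  have h : 0 < (b - a) / (n + 1) := div_pos (sub_pos.2 hab) (by positivity)
  have h1 : 0 < ⌈(s - a) / ((b - a) / (n + 1))⌉ := Int.ceil_pos.2 (div_pos (sub_pos.2 hs) h)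
  have h2 : (0 : ℝ) ≤ ((⌈(s - a) / ((b - a) / (n + 1))⌉ - 1 : ℤ) : ℝ) := by
    exact_mod_cast Int.sub_nonneg_of_le h1
  simp only [gridBelow]
  nlinarith [mul_nonneg h2 h.le]

/-- The ceiling minus one keeps the grid point strictly below `s` even when `s` is itself on the
grid, so sampling a path there yields `y(s-)` and not `y(s)`. -/
lemma tendsto_gridBelow {a b : ℝ} (hab : a < b) (s : ℝ) :
    Tendsto (fun n => gridBelow a b n s) atTop (𝓝[<] s) := by
  refine tendsto_nhdsWithin_iff.2 ⟨?_, Eventually.of_forall fun n => gridBelow_lt hab n s⟩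
  refine tendsto_of_tendsto_of_tendsto_of_le_of_le ?_ tendsto_const_nhds
    (fun n => sub_le_gridBelow hab n s) (fun n => (gridBelow_lt hab n s).le)
  have h := (tendsto_one_div_add_atTop_nhds_zero_nat (𝕜 := ℝ)).const_mul (b - a)
  have h' := (tendsto_const_nhds (x := s)).sub h
  simpa [div_eq_mul_inv] using h'

/-- The map factors through the discrete space `ℤ`, so `y` may be arbitrary. -/
lemma measurable_comp_gridBelow {E : Type*} [MeasurableSpace E] (y : ℝ → E) (a b : ℝ) (n : ℕ) :
    Measurable fun s => y (gridBelow a b n s) := by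
  have h1 : Measurable fun s : ℝ => ⌈(s - a) / ((b - a) / (n + 1))⌉ :=
    Int.measurable_ceil.comp (by fun_prop)
  exact (measurable_from_top
    (f := fun k : ℤ => y (a + ((k - 1 : ℤ) : ℝ) * ((b - a) / (n + 1))))).comp h1

variable {d : ℕ}

/-- The Riemann sum of `∫_{(a,b]} h dy` on the uniform partition of `[a, b]` into `n + 1` intervals,
with `h` evaluated at the right end points. -/
def riemannSum (a b : ℝ) (h : ℝ → ℝ) (y : ℝ → EuclideanSpace ℝ (Fin d)) (n : ℕ) :
    EuclideanSpace ℝ (Fin d) :=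
  ∑ i ∈ Finset.range (n + 1),
    h (gridPoint a b n (i + 1)) • (y (gridPoint a b n (i + 1)) - y (gridPoint a b n i))

lemma sum_smul_sub_eq {E : Type*} [AddCommGroup E] [Module ℝ E] (h : ℕ → ℝ) (y : ℕ → E) (k : ℕ) :
    ∑ i ∈ Finset.range k, h (i + 1) • (y (i + 1) - y i)
      = h k • y k - h 0 • y 0 - ∑ i ∈ Finset.range k, (h (i + 1) - h i) • y i := by
  induction k with
  | zero => simp
  | succ k ih =>
    rw [Finset.sum_range_succ, ih, Finset.sum_range_succ]
    module

/-- The integrand is constant on each cell, and continuity of `h` makes the `dh`-mass of a cell a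
plain difference. The free endpoint `k` serves the induction over cells. -/
lemma setIntegral_comp_gridBelow {a b : ℝ} (hab : a < b) {h : ℝ → ℝ}
    (hc : ContinuousOn h (Icc a b))
    (hh : BoundedVariationOn (fun s => h (max a (min s b))) univ)
    {y : ℝ → EuclideanSpace ℝ (Fin d)} {C : ℝ} (hC : ∀ s ∈ Icc a b, ‖y s‖ ≤ C) (n : ℕ)
    {k : ℕ} (hk : k ≤ n + 1) :
    ∫ᵛ s in Ioc a (gridPoint a b n k), y (gridBelow a b n s) ∂<•hh.vectorMeasure
      = ∑ i ∈ Finset.range k,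
        (h (gridPoint a b n (i + 1)) - h (gridPoint a b n i)) • y (gridPoint a b n i) := by
  have hint : hh.vectorMeasure.IntegrableOn (fun s => y (gridBelow a b n s)) (Ioc a b) := by
    unfold VectorMeasure.IntegrableOn VectorMeasure.Integrable
    rw [VectorMeasure.variation_restrict measurableSet_Ioc]
    refine Integrable.of_bound (measurable_comp_gridBelow y a b n).aestronglyMeasurable C ?_
    refine (ae_restrict_iff' measurableSet_Ioc).2 (Eventually.of_forall fun s hs => ?_)
    exact hC _ ⟨le_gridBelow hab n hs.1, (gridBelow_lt hab n s).le.trans hs.2⟩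
  induction k with
  | zero => simp [gridPoint_zero]
  | succ k ih =>
    have hk0 := gridPoint_mem hab.le (Nat.zero_le (n + 1)) (n := n)
    have hk1 := gridPoint_mem hab.le ((Nat.le_succ k).trans hk)
    have hk2 := gridPoint_mem hab.le hk
    have hle := monotone_gridPoint hab.le n (Nat.le_succ k)
    rw [Finset.sum_range_succ, ← ih ((Nat.le_succ k).trans hk), ← Ioc_union_Ioc_eq_Ioc hk1.1 hle,
      VectorMeasure.setIntegral_union (Ioc_disjoint_Ioc_of_le le_rfl) measurableSet_Ioc
        measurableSet_Ioc
        (hint.mono measurableSet_Ioc (Ioc_subset_Ioc_right hk1.2))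
        (hint.mono measurableSet_Ioc (Ioc_subset_Ioc hk1.1 hk2.2))]
    congr 1
    rw [VectorMeasure.setIntegral_congr_fun (g := fun _ => y (gridPoint a b n k))
      (fun s hs => by simp only [gridBelow_eq hab hs]), VectorMeasure.setIntegral_const,
      vectorMeasure_frozen_Ioc hab.le hc hh hk1 hk2 hle]
    simp

lemma riemannSum_halfLine {Ω : Type*} (Y : ℝ≥0 → Ω → EuclideanSpace ℝ (Fin d))
    (a b : ℝ) (h : ℝ → ℝ) (n : ℕ) :
    (fun ω => riemannSum a b h (halfLine Y ω) n) =
      ∑ i ∈ Finset.range (n + 1), fun ω => h (gridPoint a b n (i + 1)) •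
        (Y (gridPoint a b n (i + 1)).toNNReal ω - Y (gridPoint a b n i).toNNReal ω) := by
  ext1 ω
  simp [riemannSum, halfLine, Finset.sum_apply]

lemma monotone_toNNReal_gridPoint {a b : ℝ} (hab : a ≤ b) (n : ℕ) :
    Monotone fun i => (gridPoint a b n i).toNNReal :=
  fun _ _ hij => Real.toNNReal_le_toNNReal (monotone_gridPoint hab n hij)

theorem tendsto_riemannSum {a b : ℝ} (hab : a < b) {h : ℝ → ℝ} (hc : ContinuousOn h (Icc a b))
    (hh : BoundedVariationOn (fun s => h (max a (min s b))) univ)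
    {y : ℝ → EuclideanSpace ℝ (Fin d)} (hy : IsCadlag y) :
    Tendsto (riemannSum a b h y) atTop (𝓝 (pathIntegral a b h y)) := by
  obtain ⟨C, hC⟩ := hy.exists_norm_le a b
  have hsum : ∀ n, riemannSum a b h y n = h b • y b - h a • y a -
      ∫ᵛ s in Ioc a b, y (gridBelow a b n s) ∂<•hh.vectorMeasure := by
    intro n
    have h1 := setIntegral_comp_gridBelow hab hc hh hC n le_rfl
    rw [gridPoint_last] at h1
    have h2 := sum_smul_sub_eq (fun i => h (gridPoint a b n i)) (fun i => y (gridPoint a b n i))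
      (n + 1)
    simp only [gridPoint_last, gridPoint_zero] at h2
    rw [h1, riemannSum, h2]
  rw [pathIntegral, dif_pos hh]
  refine Tendsto.congr (fun n => (hsum n).symm) (tendsto_const_nhds.sub ?_)
  refine VectorMeasure.tendsto_integral_filter_of_norm_le_const
    (Eventually.of_forall fun n => (measurable_comp_gridBelow y a b n).aestronglyMeasurable)
    ⟨C, Eventually.of_forall fun n => ?_⟩ ?_
  · rw [VectorMeasure.variation_restrict measurableSet_Ioc]
    refine (ae_restrict_iff' measurableSet_Ioc).2 (Eventually.of_forall fun s hs => ?_)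
    exact hC _ ⟨le_gridBelow hab n hs.1, (gridBelow_lt hab n s).le.trans hs.2⟩
  · exact Eventually.of_forall fun s => (hy.tendsto_leftLim s).comp (tendsto_gridBelow hab s)

end Riemann

/-! ### Random vectors with law in a closed convolution class -/

section LawIn

variable {d : ℕ} {Ω : Type*} [MeasurableSpace Ω] {P : Measure Ω}
  {K : Set (ProbabilityMeasure (EuclideanSpace ℝ (Fin d)))}

/-- The law of the random vector `X` belongs to the class `K`. -/
def HasLawIn (K : Set (ProbabilityMeasure (EuclideanSpace ℝ (Fin d)))) (P : Measure Ω)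
    (X : Ω → EuclideanSpace ℝ (Fin d)) : Prop :=
  ∃ ρ ∈ K, HasLaw X (ρ : Measure (EuclideanSpace ℝ (Fin d))) P

lemma HasLawIn.congr {X Y : Ω → EuclideanSpace ℝ (Fin d)} (hX : HasLawIn K P X)
    (h : Y =ᵐ[P] X) : HasLawIn K P Y :=
  let ⟨ρ, hρ, hl⟩ := hX
  ⟨ρ, hρ, hl.congr h⟩

lemma HasLawIn.of_identDistrib {X Y : Ω → EuclideanSpace ℝ (Fin d)} (hX : HasLawIn K P X)
    (h : IdentDistrib Y X P P) : HasLawIn K P Y :=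
  let ⟨ρ, hρ, hl⟩ := hX
  ⟨ρ, hρ, h.aemeasurable_fst, h.map_eq.trans hl.map_eq⟩

lemma HasLawIn.of_tendstoInDistribution (hK : IsClosed K) {ι Ω' : Type*} [MeasurableSpace Ω']
    {P' : Measure Ω'} [IsProbabilityMeasure P] [IsProbabilityMeasure P'] {l : Filter ι} [l.NeBot]
    {X : ι → Ω → EuclideanSpace ℝ (Fin d)} {Z : Ω' → EuclideanSpace ℝ (Fin d)}
    (h : TendstoInDistribution X l Z (fun _ => P) P') (hX : ∀ᶠ i in l, HasLawIn K P (X i)) :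
    HasLawIn K P' Z := by
  refine ⟨⟨P'.map Z, Measure.isProbabilityMeasure_map h.aemeasurable_limit⟩, ?_,
    h.aemeasurable_limit, rfl⟩
  refine hK.mem_of_tendsto h.tendsto (hX.mono fun i hi => ?_)
  obtain ⟨ρ, hρ, hl⟩ := hi
  have h : (⟨P.map (X i), Measure.isProbabilityMeasure_map hl.aemeasurable⟩ :
      ProbabilityMeasure (EuclideanSpace ℝ (Fin d))) = ρ := Subtype.ext hl.map_eq
  rwa [← h] at hρ

lemma HasLawIn.of_tendstoInMeasure (hK : IsClosed K) [IsProbabilityMeasure P]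
    {X : ℕ → Ω → EuclideanSpace ℝ (Fin d)} {Z : Ω → EuclideanSpace ℝ (Fin d)}
    (hX : ∀ n, HasLawIn K P (X n)) (h : TendstoInMeasure P X atTop Z) : HasLawIn K P Z :=
  .of_tendstoInDistribution hK
    (h.tendstoInDistribution fun n => let ⟨_, _, hl⟩ := hX n; hl.aemeasurable)
    (Eventually.of_forall hX)

lemma HasLawIn.of_ae_tendsto (hK : IsClosed K) [IsProbabilityMeasure P]
    {X : ℕ → Ω → EuclideanSpace ℝ (Fin d)} {Z : Ω → EuclideanSpace ℝ (Fin d)}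
    (hX : ∀ n, HasLawIn K P (X n)) (h : ∀ᵐ ω ∂P, Tendsto (fun n => X n ω) atTop (𝓝 (Z ω))) :
    HasLawIn K P Z :=
  .of_tendstoInMeasure hK hX
    (tendstoInMeasure_of_tendsto_ae
      (fun n => let ⟨_, _, hl⟩ := hX n; hl.aemeasurable.aestronglyMeasurable) h)

lemma HasLawIn.add (hK : IsClosedConvClass K) [IsProbabilityMeasure P]
    {X Y : Ω → EuclideanSpace ℝ (Fin d)} (hX : HasLawIn K P X) (hY : HasLawIn K P Y)
    (h : IndepFun X Y P) : HasLawIn K P (X + Y) := by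
  obtain ⟨ρ, hρ, hl⟩ := hX
  obtain ⟨σ, hσ, hm⟩ := hY
  refine ⟨probConv ρ σ, hK.conv_mem _ hρ _ hσ, hl.aemeasurable.add hm.aemeasurable, ?_⟩
  rw [h.map_add_eq_map_conv_map₀ hl.aemeasurable hm.aemeasurable, hl.map_eq, hm.map_eq]
  rfl

/-- The factor `c = 0` is not an admissible dilation; `h0` covers it. -/
lemma HasLawIn.const_smul (hK : IsClosedConvClass K)
    (h0 : HasLawIn K P fun _ => (0 : EuclideanSpace ℝ (Fin d))) {c : ℝ} (hc : 0 ≤ c)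
    {X : Ω → EuclideanSpace ℝ (Fin d)} (hX : HasLawIn K P X) :
    HasLawIn K P fun ω => c • X ω := by
  rcases hc.eq_or_lt with rfl | hc
  · simpa using h0
  · obtain ⟨ρ, hρ, hl⟩ := hX
    refine ⟨dilation c ρ, hK.dilation_mem c hc ρ hρ, hl.aemeasurable.const_smul c, ?_⟩
    have hm : Measurable fun x : EuclideanSpace ℝ (Fin d) => c • x := measurable_const_smul c
    change P.map ((fun x => c • x) ∘ X) = _
    rw [← AEMeasurable.map_map_of_aemeasurable hm.aemeasurable hl.aemeasurable, hl.map_eq]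
    rfl

end LawIn

/-! ### Laws of sums of weighted increments of a Lévy process -/

section Levy

variable {d : ℕ} {Ω : Type*} [MeasurableSpace Ω] {P : Measure Ω}
  {K : Set (ProbabilityMeasure (EuclideanSpace ℝ (Fin d)))}
  {ν : ProbabilityMeasure (EuclideanSpace ℝ (Fin d))}
  {Y : ℝ≥0 → Ω → EuclideanSpace ℝ (Fin d)}

lemma IsLevyProcess.ae_isCadlag (hY : IsLevyProcess P ν Y) :
    ∀ᵐ ω ∂P, IsCadlag (halfLine Y ω) :=
  hY.cadlag.mono fun _ hω => isCadlag_comp_toNNReal hω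

lemma IsLevyProcess.identDistrib_sub (hY : IsLevyProcess P ν Y) {s t : ℝ≥0} (hst : s ≤ t) :
    IdentDistrib (Y t - Y s) (Y (t - s)) P P := by
  simpa [add_tsub_cancel_of_le hst] using hY.stationary_increments s (t - s)

/-- Stationarity reduces stochastic continuity at any time to time `0`, where right-continuity of
the paths suffices. -/
lemma IsLevyProcess.measure_le_norm_sub (hY : IsLevyProcess P ν Y) (s t : ℝ≥0) (ε : ℝ) :
    P {ω | ε ≤ ‖Y s ω - Y t ω‖} = P {ω | ε ≤ ‖Y (nndist s t) ω‖} := by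
  have hm : MeasurableSet {x : EuclideanSpace ℝ (Fin d) | ε ≤ ‖x‖} :=
    measurableSet_le measurable_const measurable_norm
  have key : ∀ s t : ℝ≥0, t ≤ s →
      P {ω | ε ≤ ‖Y s ω - Y t ω‖} = P {ω | ε ≤ ‖Y (nndist s t) ω‖} := by
    intro s t hts
    have h : nndist s t = s - t := by
      rw [NNReal.nndist_eq, tsub_eq_zero_of_le hts, max_eq_left zero_le]
    rw [h]
    exact (hY.identDistrib_sub hts).measure_mem_eq hm
  rcases le_total t s with h | h
  · exact key s t h
  · simpa only [norm_sub_rev, nndist_comm] using key t s h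

variable [IsProbabilityMeasure P]

lemma IsLevyProcess.tendstoInMeasure_zero (hY : IsLevyProcess P ν Y) {u : ℕ → ℝ≥0}
    (hu : Tendsto u atTop (𝓝 0)) :
    TendstoInMeasure P (fun n => Y (u n)) atTop (fun _ => (0 : EuclideanSpace ℝ (Fin d))) := by
  refine tendstoInMeasure_of_tendsto_ae (fun n => (hY.measurable _).aestronglyMeasurable) ?_
  filter_upwards [hY.cadlag, hY.start_zero] with ω hω h0
  have h := (hω 0).1
  rw [ContinuousWithinAt, h0] at h
  refine h.comp (tendsto_nhdsWithin_iff.2 ⟨hu, Eventually.of_forall fun n => ?_⟩)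
  exact zero_le (a := u n)

lemma IsLevyProcess.tendstoInMeasure (hY : IsLevyProcess P ν Y) {u : ℕ → ℝ≥0} {t : ℝ≥0}
    (hu : Tendsto u atTop (𝓝 t)) : TendstoInMeasure P (fun n => Y (u n)) atTop (Y t) := by
  rw [tendstoInMeasure_iff_norm]
  intro ε hε
  simp only [hY.measure_le_norm_sub]
  have hd : Tendsto (fun n => nndist (u n) t) atTop (𝓝 0) := by
    simpa using hu.nndist (tendsto_const_nhds (x := t))
  simpa using tendstoInMeasure_iff_norm.1 (hY.tendstoInMeasure_zero hd) ε hε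

/-- The convolution semigroup of the laws of a Lévy process. -/
def IsLevyProcess.law (hY : IsLevyProcess P ν Y) (t : ℝ≥0) :
    ProbabilityMeasure (EuclideanSpace ℝ (Fin d)) :=
  ⟨P.map (Y t), Measure.isProbabilityMeasure_map (hY.measurable t).aemeasurable⟩

lemma IsLevyProcess.isConvPow_law (hY : IsLevyProcess P ν Y) (t : ℝ≥0) :
    IsConvPow ν t (hY.law t) := by
  refine ⟨hY.law, ?_, ?_, fun s t => ?_, ?_, rfl⟩
  · refine continuous_iff_seqContinuous.2 fun u s hu => ?_
    exact ((hY.tendstoInMeasure hu).tendstoInDistribution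
      fun n => (hY.measurable _).aemeasurable).tendsto
  · exact (hasLaw_dirac_of_ae_eq hY.start_zero).map_eq
  · have hind : IndepFun (Y s) (Y (s + t) - Y s) P :=
      hY.indep_increments.indepFun_eval_sub zero_le le_self_add hY.start_zero
    have h := hind.map_add_eq_map_conv_map (hY.measurable s)
      ((hY.measurable (s + t)).sub (hY.measurable s))
    rw [add_sub_cancel, (hY.stationary_increments s t).map_eq] at h
    exact Subtype.ext h
  · exact Subtype.ext hY.law_one.map_eq

lemma IsLevyProcess.hasLawIn_of_pos (hK : IsClosedConvClass K) (hν : ν ∈ K)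
    (hY : IsLevyProcess P ν Y) {t : ℝ≥0} (ht : 0 < t) : HasLawIn K P (Y t) :=
  ⟨hY.law t, hK.convPow_mem t ht ν hν _ (hY.isConvPow_law t), (hY.measurable t).aemeasurable, rfl⟩

/-- The point mass at `0` is the weak limit of `ν^{∗1/(n+1)}`. -/
lemma IsLevyProcess.hasLawIn_zero (hK : IsClosedConvClass K) (hν : ν ∈ K)
    (hY : IsLevyProcess P ν Y) : HasLawIn K P fun _ => (0 : EuclideanSpace ℝ (Fin d)) := by
  have hu : Tendsto (fun n : ℕ => 1 / ((n : ℝ≥0) + 1)) atTop (𝓝 0) :=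
    tendsto_one_div_add_atTop_nhds_zero_nat
  exact .of_tendstoInMeasure hK.isClosed (fun n => hY.hasLawIn_of_pos hK hν (by positivity))
    (hY.tendstoInMeasure_zero hu)

lemma IsLevyProcess.hasLawIn (hK : IsClosedConvClass K) (hν : ν ∈ K)
    (hY : IsLevyProcess P ν Y) (t : ℝ≥0) : HasLawIn K P (Y t) := by
  rcases eq_zero_or_pos t with rfl | ht
  · exact (hY.hasLawIn_zero hK hν).congr hY.start_zero
  · exact hY.hasLawIn_of_pos hK hν ht

lemma IsLevyProcess.hasLawIn_sum (hK : IsClosedConvClass K) (hν : ν ∈ K)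
    (hY : IsLevyProcess P ν Y) {u : ℕ → ℝ≥0} (hu : Monotone u) {c : ℕ → ℝ} {n : ℕ}
    (hc : ∀ i < n, 0 ≤ c i) :
    HasLawIn K P (∑ i ∈ Finset.range n, fun ω => c i • (Y (u (i + 1)) ω - Y (u i) ω)) := by
  have h0 := hY.hasLawIn_zero hK hν
  have hind : iIndepFun (fun i ω => c i • (Y (u (i + 1)) ω - Y (u i) ω)) P :=
    (hY.indep_increments.nat hu).comp (fun i x => c i • x) fun i => measurable_const_smul _
  have hm : ∀ i, Measurable fun ω => c i • (Y (u (i + 1)) ω - Y (u i) ω) :=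
    fun i => ((hY.measurable (u (i + 1))).sub (hY.measurable (u i))).const_smul (c i)
  induction n with
  | zero => simpa using! h0
  | succ n ih =>
    rw [Finset.sum_range_succ]
    refine (ih fun i hi => hc i (hi.trans n.lt_succ_self)).add hK ?_
      (hind.indepFun_finsetSum_of_notMem hm Finset.notMem_range_self)
    refine HasLawIn.const_smul hK h0 (hc n n.lt_succ_self) ?_
    exact (hY.hasLawIn hK hν _).of_identDistrib (hY.identDistrib_sub (hu n.le_succ))

lemma IsLevyProcess.hasLawIn_sum_antitone (hK : IsClosedConvClass K) (hν : ν ∈ K)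
    (hY : IsLevyProcess P ν Y) {u : ℕ → ℝ≥0} (hu : Antitone u) {c : ℕ → ℝ} {n : ℕ}
    (hc : ∀ i < n, 0 ≤ c i) :
    HasLawIn K P (∑ i ∈ Finset.range n, fun ω => c i • (Y (u i) ω - Y (u (i + 1)) ω)) := by
  -- Reading the times backwards makes them increasing; cell `j` of the reversed sequence is cell `n
  -- - 1 - j` of the original.
  have h := hY.hasLawIn_sum hK hν (u := fun j => u (n - j)) (c := fun j => c (n - 1 - j)) (n := n)
    (fun i j hij => hu (Nat.sub_le_sub_left hij n)) (fun i hi => hc _ (by omega))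
  rw [← Finset.sum_range_reflect]
  convert h using 2 with i hi
  have hi' := Finset.mem_range.1 hi
  have e1 : n - (i + 1) = n - 1 - i := by omega
  have e2 : n - 1 - i + 1 = n - i := by omega
  simp only [e1, e2]

/-- A Lévy process has no fixed times of discontinuity. -/
lemma IsLevyProcess.ae_leftLim_eq (hY : IsLevyProcess P ν Y) {s : ℝ} (hs : 0 < s) :
    ∀ᵐ ω ∂P, Function.leftLim (halfLine Y ω) s = halfLine Y ω s := by
  -- Along times approaching `s` from below, `Y` tends in measure to the left limit (pathwise) and
  -- to `Y s` (stochastic continuity); such limits agree almost surely.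
  have hlim : Tendsto (fun n => gridBelow 0 s n s) atTop (𝓝[<] s) := tendsto_gridBelow hs s
  have hu : Tendsto (fun n => (gridBelow 0 s n s).toNNReal) atTop (𝓝 s.toNNReal) :=
    (continuous_real_toNNReal.tendsto s).comp (hlim.mono_right nhdsWithin_le_nhds)
  have h2 : TendstoInMeasure P (fun n => Y (gridBelow 0 s n s).toNNReal) atTop
      (fun ω => Function.leftLim (halfLine Y ω) s) := by
    refine tendstoInMeasure_of_tendsto_ae (fun n => (hY.measurable _).aestronglyMeasurable) ?_
    filter_upwards [hY.cadlag] with ω hω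
    exact ((isCadlag_comp_toNNReal hω).tendsto_leftLim s).comp hlim
  exact tendstoInMeasure_ae_unique h2 (hY.tendstoInMeasure hu)

end Levy

/-! ### Path integrals along two independent Lévy processes -/

section TwoProcesses

variable {d : ℕ} {Ω : Type*} [MeasurableSpace Ω] {P : Measure Ω}
  {K : Set (ProbabilityMeasure (EuclideanSpace ℝ (Fin d)))}
  {ν : ProbabilityMeasure (EuclideanSpace ℝ (Fin d))}
  {Y Y₁ Y₂ : ℝ≥0 → Ω → EuclideanSpace ℝ (Fin d)}

lemma indepFun_sum_smul_sub (hindep : IndepFun (fun ω s => Y₁ s ω) (fun ω s => Y₂ s ω) P)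
    (c₁ c₂ : ℕ → ℝ) (u₁ v₁ u₂ v₂ : ℕ → ℝ≥0) (m n : ℕ) :
    IndepFun (∑ i ∈ Finset.range m, fun ω => c₁ i • (Y₁ (u₁ i) ω - Y₁ (v₁ i) ω))
      (∑ i ∈ Finset.range n, fun ω => c₂ i • (Y₂ (u₂ i) ω - Y₂ (v₂ i) ω)) P := by
  have hm : ∀ (c : ℕ → ℝ) (u v : ℕ → ℝ≥0) (n : ℕ),
      Measurable fun f : ℝ≥0 → EuclideanSpace ℝ (Fin d) =>
        ∑ i ∈ Finset.range n, c i • (f (u i) - f (v i)) :=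
    fun c u v n => Finset.measurable_fun_sum _ fun i _ =>
      ((measurable_pi_apply (u i)).sub (measurable_pi_apply (v i))).const_smul (c i)
  have h := hindep.comp (hm c₁ u₁ v₁ m) (hm c₂ u₂ v₂ n)
  convert h using 1 <;> · ext1 ω; simp [Finset.sum_apply]

lemma ae_isCadlag_twoSided (hY₁ : IsLevyProcess P ν Y₁) (hY₂ : IsLevyProcess P ν Y₂) :
    ∀ᵐ ω ∂P, IsCadlag (twoSided Y₁ Y₂ ω) := by
  filter_upwards [hY₁.ae_isCadlag, hY₂.ae_isCadlag] with ω h1 h2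
  exact h1.piecewise h2.reflect

variable [IsProbabilityMeasure P]

/-- One formula for both signs of `s`, since truncation sends the other process to time `0`.
Increments then split into a `Y₁` part and a `Y₂` part even on a cell straddling `0`. -/
lemma ae_twoSided_eq (hY₁ : IsLevyProcess P ν Y₁) (hY₂ : IsLevyProcess P ν Y₂) (s : ℝ) :
    ∀ᵐ ω ∂P, twoSided Y₁ Y₂ ω s = Y₁ s.toNNReal ω - Y₂ (-s).toNNReal ω := by
  rcases le_or_gt 0 s with hs | hs
  · filter_upwards [hY₂.start_zero] with ω h
    simp [twoSided, hs, halfLine, Real.toNNReal_of_nonpos (neg_nonpos.2 hs), h]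
  · filter_upwards [hY₁.start_zero, hY₂.ae_leftLim_eq (neg_pos.2 hs)] with ω h1 h2
    simp [twoSided, not_le.2 hs, h2, halfLine, Real.toNNReal_of_nonpos hs.le, h1]

lemma hasLawIn_pathIntegral_add (hK : IsClosedConvClass K) (hν : ν ∈ K)
    (hY₁ : IsLevyProcess P ν Y₁) (hY₂ : IsLevyProcess P ν Y₂)
    (hindep : IndepFun (fun ω s => Y₁ s ω) (fun ω s => Y₂ s ω) P)
    {a₁ b₁ a₂ b₂ : ℝ} (hab₁ : a₁ < b₁) (hab₂ : a₂ < b₂) {h₁ h₂ : ℝ → ℝ}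
    (hc₁ : ContinuousOn h₁ (Icc a₁ b₁)) (hc₂ : ContinuousOn h₂ (Icc a₂ b₂))
    (hv₁ : BoundedVariationOn (fun s => h₁ (max a₁ (min s b₁))) univ)
    (hv₂ : BoundedVariationOn (fun s => h₂ (max a₂ (min s b₂))) univ)
    (hn₁ : ∀ s ∈ Icc a₁ b₁, 0 ≤ h₁ s) (hn₂ : ∀ s ∈ Icc a₂ b₂, 0 ≤ h₂ s) :
    HasLawIn K P fun ω =>
      pathIntegral a₁ b₁ h₁ (halfLine Y₁ ω) + pathIntegral a₂ b₂ h₂ (halfLine Y₂ ω) := by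
  refine .of_ae_tendsto hK.isClosed (X := fun n => (fun ω => riemannSum a₁ b₁ h₁ (halfLine Y₁ ω) n) +
    fun ω => riemannSum a₂ b₂ h₂ (halfLine Y₂ ω) n) (fun n => ?_) ?_
  · rw [riemannSum_halfLine, riemannSum_halfLine]
    refine HasLawIn.add hK ?_ ?_ (indepFun_sum_smul_sub hindep _ _ _ _ _ _ _ _)
    · exact hY₁.hasLawIn_sum hK hν (monotone_toNNReal_gridPoint hab₁.le n)
        fun i hi => hn₁ _ (gridPoint_mem hab₁.le (by omega))
    · exact hY₂.hasLawIn_sum hK hν (monotone_toNNReal_gridPoint hab₂.le n)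
        fun i hi => hn₂ _ (gridPoint_mem hab₂.le (by omega))
  · filter_upwards [hY₁.ae_isCadlag, hY₂.ae_isCadlag] with ω h1 h2
    exact (tendsto_riemannSum hab₁ hc₁ hv₁ h1).add (tendsto_riemannSum hab₂ hc₂ hv₂ h2)

lemma hasLawIn_pathIntegral_twoSided (hK : IsClosedConvClass K) (hν : ν ∈ K)
    (hY₁ : IsLevyProcess P ν Y₁) (hY₂ : IsLevyProcess P ν Y₂)
    (hindep : IndepFun (fun ω s => Y₁ s ω) (fun ω s => Y₂ s ω) P)
    {a b : ℝ} (hab : a < b) {h : ℝ → ℝ} (hc : ContinuousOn h (Icc a b))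
    (hv : BoundedVariationOn (fun s => h (max a (min s b))) univ)
    (hn : ∀ s ∈ Icc a b, 0 ≤ h s) :
    HasLawIn K P fun ω => pathIntegral a b h (twoSided Y₁ Y₂ ω) := by
  refine .of_ae_tendsto hK.isClosed (X := fun n ω => riemannSum a b h (twoSided Y₁ Y₂ ω) n)
    (fun n => ?_) ((ae_isCadlag_twoSided hY₁ hY₂).mono fun ω hω => tendsto_riemannSum hab hc hv hω)
  set p : ℕ → ℝ≥0 := fun i => (gridPoint a b n i).toNNReal
  set q : ℕ → ℝ≥0 := fun i => (-gridPoint a b n i).toNNReal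
  set c : ℕ → ℝ := fun i => h (gridPoint a b n (i + 1))
  have hq : Antitone q :=
    fun i j hij => Real.toNNReal_le_toNNReal (neg_le_neg (monotone_gridPoint hab.le n hij))
  have hc0 : ∀ i < n + 1, 0 ≤ c i := fun i hi => hn _ (gridPoint_mem hab.le (by omega))
  refine ((hY₁.hasLawIn_sum hK hν (monotone_toNNReal_gridPoint hab.le n) hc0).add hK
    (hY₂.hasLawIn_sum_antitone hK hν hq hc0)
    (indepFun_sum_smul_sub hindep _ _ _ _ _ _ _ _)).congr ?_
  filter_upwards [ae_all_iff.2 fun i => ae_twoSided_eq hY₁ hY₂ (gridPoint a b n i)] with ω hω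
  simp only [riemannSum, hω, Pi.add_apply, Finset.sum_apply, ← Finset.sum_add_distrib]
  refine Finset.sum_congr rfl fun i _ => ?_
  simp only [q, c]
  module

end TwoProcesses

/-! ### The kernels of the fractional integrals -/

section Kernels

variable {α t : ℝ}

lemma continuous_maKernel (hα : 0 < α) : Continuous (maKernel α t) := by
  unfold maKernel
  exact ((by fun_prop : Continuous fun s => max 0 (t - s)).rpow_const fun _ => Or.inr hα.le).sub
    ((by fun_prop : Continuous fun s : ℝ => max 0 (-s)).rpow_const fun _ => Or.inr hα.le)

lemma maKernel_nonneg (hα : 0 < α) (ht : 0 < t) (s : ℝ) : 0 ≤ maKernel α t s :=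
  sub_nonneg.2 <| Real.rpow_le_rpow (le_max_left _ _)
    (max_le_max le_rfl (by linarith)) hα.le

lemma monotone_neg_max_rpow (hα : 0 < α) (t : ℝ) : Monotone fun s => -(max 0 (t - s)) ^ α :=
  fun _ _ hxy => neg_le_neg <| Real.rpow_le_rpow (le_max_left _ _)
    (max_le_max le_rfl (by linarith)) hα.le

lemma boundedVariationOn_maKernel (hα : 0 < α) {a b : ℝ} (hab : a ≤ b) :
    BoundedVariationOn (fun s => maKernel α t (max a (min s b))) univ := by
  -- Both powers decrease in `s`, so the kernel is written as `(-(-s)₊^α) - (-(t-s)₊^α)`.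
  refine boundedVariationOn_frozen_of_eq_sub hab ((monotone_neg_max_rpow hα 0).monotoneOn _)
    ((monotone_neg_max_rpow hα t).monotoneOn _) fun s _ => ?_
  simp only [maKernel, zero_sub]
  ring

lemma monotoneOn_add_rpow (hα : 0 < α) (ht : 0 ≤ t) (b : ℝ) :
    MonotoneOn (fun s => (t + s) ^ α) (Icc 0 b) :=
  fun _ hx _ _ hxy => Real.rpow_le_rpow (add_nonneg ht hx.1) (by linarith) hα.le

lemma continuous_add_rpow (hα : 0 < α) (t : ℝ) : Continuous fun s : ℝ => (t + s) ^ α :=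
  (by fun_prop : Continuous fun s : ℝ => t + s).rpow_const fun _ => Or.inr hα.le

lemma continuous_add_rpow_sub_rpow (hα : 0 < α) (t : ℝ) :
    Continuous fun s : ℝ => (t + s) ^ α - s ^ α :=
  (continuous_add_rpow hα t).sub (Real.continuous_rpow_const hα.le)

lemma boundedVariationOn_add_rpow_sub_rpow (hα : 0 < α) (ht : 0 ≤ t) {b : ℝ} (hb : 0 ≤ b) :
    BoundedVariationOn
      (fun s => (fun s : ℝ => (t + s) ^ α - s ^ α) (max 0 (min s b))) univ :=
  boundedVariationOn_frozen_of_eq_sub (f := fun s => (t + s) ^ α) (g := fun s => s ^ α)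
    (h := fun s : ℝ => (t + s) ^ α - s ^ α) hb
    (monotoneOn_add_rpow hα ht b)
    (fun _ hx _ _ hxy => Real.rpow_le_rpow hx.1 hxy hα.le) fun _ _ => rfl

lemma continuous_sub_rpow (hα : 0 < α) (t : ℝ) : Continuous fun s : ℝ => (t - s) ^ α :=
  (by fun_prop : Continuous fun s : ℝ => t - s).rpow_const fun _ => Or.inr hα.le

lemma boundedVariationOn_sub_rpow (hα : 0 < α) (ht : 0 ≤ t) :
    BoundedVariationOn (fun s => (fun s : ℝ => (t - s) ^ α) (max 0 (min s t))) univ := by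
  refine boundedVariationOn_frozen_of_eq_sub (f := fun _ => 0)
    (g := fun s => -(max 0 (t - s)) ^ α) (h := fun s : ℝ => (t - s) ^ α) ht monotoneOn_const
    ((monotone_neg_max_rpow hα t).monotoneOn _) fun s hs => ?_
  simp only [max_eq_right (sub_nonneg.2 hs.2), zero_sub, neg_neg]

lemma hasLawIn_truncU_add_partV {d : ℕ} {Ω : Type*} [MeasurableSpace Ω] {P : Measure Ω}
    [IsProbabilityMeasure P] {K : Set (ProbabilityMeasure (EuclideanSpace ℝ (Fin d)))}
    {ν : ProbabilityMeasure (EuclideanSpace ℝ (Fin d))}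
    {Y₁ Y₂ : ℝ≥0 → Ω → EuclideanSpace ℝ (Fin d)} (hα : 0 < α) (hK : IsClosedConvClass K)
    (hν : ν ∈ K) (hY₁ : IsLevyProcess P ν Y₁) (hY₂ : IsLevyProcess P ν Y₂)
    (hindep : IndepFun (fun ω s => Y₁ s ω) (fun ω s => Y₂ s ω) P) {b : ℝ} (ht : 0 < t)
    (hb : 0 < b) : HasLawIn K P fun ω => truncU α t b Y₂ ω + partV α t Y₁ ω :=
  hasLawIn_pathIntegral_add hK hν hY₂ hY₁ hindep.symm hb ht
    (continuous_add_rpow_sub_rpow hα t).continuousOn (continuous_sub_rpow hα t).continuousOn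
    (boundedVariationOn_add_rpow_sub_rpow hα ht.le hb.le) (boundedVariationOn_sub_rpow hα ht.le)
    (fun _ hs => sub_nonneg.2 (Real.rpow_le_rpow hs.1 (by linarith) hα.le))
    (fun _ hs => Real.rpow_nonneg (sub_nonneg.2 hs.2) _)

end Kernels

end FractionalLevy

end

theorem corollary4 {d : ℕ}
    {Ω Ω' : Type*} [MeasurableSpace Ω] [MeasurableSpace Ω']
    (P : Measure Ω) [IsProbabilityMeasure P] (P' : Measure Ω') [IsProbabilityMeasure P']
    (α : ℝ) (hα : 0 < α) (hα' : α < 1 / 2)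
    (K : Set (ProbabilityMeasure (EuclideanSpace ℝ (Fin d))))
    (hK : FractionalLevy.IsClosedConvClass K)
    (ν : ProbabilityMeasure (EuclideanSpace ℝ (Fin d))) (hν : ν ∈ K)
    (Y₁ Y₂ : ℝ≥0 → Ω → EuclideanSpace ℝ (Fin d))
    (hY₁ : FractionalLevy.IsLevyProcess P ν Y₁) (hY₂ : FractionalLevy.IsLevyProcess P ν Y₂)
    (hindep : IndepFun (fun ω s => Y₁ s ω) (fun ω s => Y₂ s ω) P) :
    (∀ t b : ℝ, 0 < t → 0 < b → ∃ ρ ∈ K,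
      HasLaw (fun ω => FractionalLevy.truncU α t b Y₂ ω + FractionalLevy.partV α t Y₁ ω)
        (ρ : Measure (EuclideanSpace ℝ (Fin d))) P) ∧
    (∀ Z : ℝ → Ω' → EuclideanSpace ℝ (Fin d), ∀ t : ℝ, 0 < t →
      FractionalLevy.IsMAFLPValue P P' α Y₁ Y₂ t (Z t) → ∃ ρ ∈ K,
      HasLaw (Z t) (ρ : Measure (EuclideanSpace ℝ (Fin d))) P') := by
  refine ⟨fun t b ht hb =>
    FractionalLevy.hasLawIn_truncU_add_partV hα hK hν hY₁ hY₂ hindep ht hb, fun Z t ht hZ => ?_⟩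
  refine FractionalLevy.HasLawIn.of_tendstoInDistribution hK.isClosed hZ ?_
  -- The threshold only serves to make the interval `(-p.1, p.2]` nondegenerate.
  filter_upwards [eventually_ge_atTop ((1, 1) : ℝ≥0 × ℝ≥0)] with p hp
  have h1 : (1 : ℝ) ≤ p.1 := by exact_mod_cast hp.1
  have h2 : (1 : ℝ) ≤ p.2 := by exact_mod_cast hp.2
  have hab : -(p.1 : ℝ) < p.2 := by linarith
  exact FractionalLevy.hasLawIn_pathIntegral_twoSided hK hν hY₁ hY₂ hindep hab
    (FractionalLevy.continuous_maKernel hα).continuousOn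
    (FractionalLevy.boundedVariationOn_maKernel hα hab.le)
    fun s _ => FractionalLevy.maKernel_nonneg hα ht s
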